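/- Let $\mathbb T=\mathbb R/\mathbb Z$ be the circle group, written additively, and let $\mathbb T^2$ carry its usual Lebesgue probability measure. Consider the toral automorphisms $\alpha_1(x,y)=(y,x)$ and $\alpha_2(x,y)=(x,x+y)$ of $\mathbb T^2$ (in multiplicative notation, $\alpha_2(x,y)=(x,xy)$). Then $\alpha_1$ and $\alpha_2$ have a non-trivial common coboundary in $L_2(\mathbb T^2)$ with transfer functions in $L_2(\mathbb T^2)$: there exist $F,h_1,h_2\in L_2(\mathbb T^2)$ with $F\neq 0$ such that $$F = h_1-h_1\circ\alpha_1 = h_2-h_2\circ\alpha_2$$ almost everywhere. This holds both for real-valued and for complex-valued $L_2(\mathbb T^2)$. -/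

import Mathlib

open MeasureTheory
open scoped ENNReal

/-- Let `τ` be a measure-preserving self-map of `(X, μ)`. A class `f ∈ L_r(X, μ)` is a
`τ`-coboundary with transfer function in `L_r(X, μ)` if there is `h ∈ L_r(X, μ)` such that
`f = h - h ∘ τ` in `L_r(X, μ)`, that is, almost everywhere. -/
def IsCoboundary {X : Type*} [MeasurableSpace X] {μ : Measure X} (𝕜 : Type*) [RCLike 𝕜]
    {r : ℝ≥0∞} (τ : X → X) (hτ : MeasurePreserving τ μ μ) (f : Lp 𝕜 r μ) : Prop :=
  ∃ h : Lp 𝕜 r μ, f = h - Lp.compMeasurePreserving τ hτ h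

/-- The two-torus `𝕋²`, with `𝕋 = ℝ / ℤ` written additively. Its canonical measure `volume` is
the product of the Lebesgue measures of total mass one. -/
abbrev Torus2 : Type := UnitAddCircle × UnitAddCircle

/-- The toral automorphism `(x, y) ↦ (y, x)`. -/
def torusAlpha1 (z : Torus2) : Torus2 := (z.2, z.1)

/-- The toral automorphism `(x, y) ↦ (x, x + y)`. -/
def torusAlpha2 (z : Torus2) : Torus2 := (z.1, z.1 + z.2)

theorem measurePreserving_torusAlpha1 :
    MeasurePreserving torusAlpha1 (volume : Measure Torus2) (volume : Measure Torus2) :=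
  Measure.measurePreserving_swap

theorem measurePreserving_torusAlpha2 :
    MeasurePreserving torusAlpha2 (volume : Measure Torus2) (volume : Measure Torus2) :=
  measurePreserving_prod_add (volume : Measure UnitAddCircle) (volume : Measure UnitAddCircle)

/-!
The characters of `𝕋²` are `(x, y) ↦ m x + n y`, on which `torusAlpha1` acts by
`(m, n) ↦ (n, m)` and `torusAlpha2` by `(m, n) ↦ (m + n, n)`. Since `torusAlpha1` is an
involution, a function `F` is a coboundary for it as soon as `F ∘ torusAlpha1 = -F`, with transfer
function `F / 2`. For `torusAlpha2`, any difference of two functions in the same orbit is a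
coboundary, by telescoping. Both can be achieved with four frequencies: for an even function `e` on
`𝕋`, take
`F (x, y) = e (x + 2y) - e (2x + y) + e (2x - y) - e (2y - x)`.
It is antisymmetric because `e` is even, while `(-1, 2)` and `(1, 2)` are consecutive in their
`torusAlpha2`-orbit, and `(-2, 1)` and `(2, 1)` are joined by
`(-2, 1), (-1, 1), (0, 1), (1, 1), (2, 1)`.

Taking for `e` the distance to `0` makes `F` continuous, with value `1 / 2` at `(1 / 4, 1 / 8)`.
As Lebesgue measure charges every nonempty open set, `F` is nonzero in `L²`
(`ContinuousMap.toLp_injective`).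
-/

/-- A pointwise coboundary equation between continuous functions on a compact space passes to
`L^p`. -/
theorem isCoboundary_toLp {X : Type*} [TopologicalSpace X] [CompactSpace X] [MeasurableSpace X]
    [BorelSpace X] {μ : Measure X} [IsFiniteMeasure μ] (𝕜 : Type*) [RCLike 𝕜] {p : ℝ≥0∞}
    [Fact (1 ≤ p)] {τ : X → X} (hτ : MeasurePreserving τ μ μ) (f h : C(X, 𝕜))
    (hfh : ∀ x, f x = h x - h (τ x)) :
    IsCoboundary 𝕜 τ hτ (ContinuousMap.toLp p μ 𝕜 f) := by
  refine ⟨ContinuousMap.toLp p μ 𝕜 h, ?_⟩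
  apply Lp.ext
  have h_comp := hτ.quasiMeasurePreserving.ae_eq_comp
    (ContinuousMap.coeFn_toLp (p := p) (𝕜 := 𝕜) μ h)
  filter_upwards [ContinuousMap.coeFn_toLp (p := p) (𝕜 := 𝕜) μ f,
    ContinuousMap.coeFn_toLp (p := p) (𝕜 := 𝕜) μ h, h_comp,
    Lp.coeFn_sub (ContinuousMap.toLp p μ 𝕜 h)
      (Lp.compMeasurePreserving τ hτ (ContinuousMap.toLp p μ 𝕜 h)),
    Lp.coeFn_compMeasurePreserving (ContinuousMap.toLp p μ 𝕜 h) hτ] with x h₁ h₂ h₃ h₄ h₅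
  rw [h₁, h₄, Pi.sub_apply, h₅, h₂, h₃, Function.comp_apply, hfh]

/-- The distance to `0` on `𝕋`, with values in `𝕜`. -/
noncomputable def circleDist (𝕜 : Type*) [RCLike 𝕜] (t : UnitAddCircle) : 𝕜 := ((‖t‖ : ℝ) : 𝕜)

theorem continuous_circleDist (𝕜 : Type*) [RCLike 𝕜] : Continuous (circleDist 𝕜) :=
  RCLike.continuous_ofReal.comp continuous_norm

theorem circleDist_sub_comm (𝕜 : Type*) [RCLike 𝕜] (s t : UnitAddCircle) :
    circleDist 𝕜 (s - t) = circleDist 𝕜 (t - s) := by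
  simp only [circleDist, norm_sub_rev]

/-- The function `e (x + 2y) - e (2x + y) + e (2x - y) - e (2y - x)`, where `e` is the distance
to `0`. -/
noncomputable def commonCoboundary (𝕜 : Type*) [RCLike 𝕜] : C(Torus2, 𝕜) where
  toFun z := circleDist 𝕜 (z.1 + 2 • z.2) - circleDist 𝕜 (2 • z.1 + z.2)
    + circleDist 𝕜 (2 • z.1 - z.2) - circleDist 𝕜 (2 • z.2 - z.1)
  continuous_toFun := by
    have := continuous_circleDist 𝕜
    fun_prop

/-- The transfer function of `commonCoboundary` for `torusAlpha2`: the sum of `e (k x + y)` over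
`-2 ≤ k ≤ 1`, which telescopes to `e (2x - y) - e (2x + y)`, minus `e (2y - x)`, which accounts
for `e (x + 2y) - e (2y - x)`. -/
noncomputable def shearTransfer (𝕜 : Type*) [RCLike 𝕜] : C(Torus2, 𝕜) where
  toFun z := circleDist 𝕜 (z.2 - 2 • z.1) + circleDist 𝕜 (z.2 - z.1) + circleDist 𝕜 z.2
    + circleDist 𝕜 (z.1 + z.2) - circleDist 𝕜 (2 • z.2 - z.1)
  continuous_toFun := by
    have := continuous_circleDist 𝕜
    fun_prop

theorem commonCoboundary_swap (𝕜 : Type*) [RCLike 𝕜] (z : Torus2) :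
    commonCoboundary 𝕜 (torusAlpha1 z) = -commonCoboundary 𝕜 z := by
  simp only [commonCoboundary, torusAlpha1, ContinuousMap.coe_mk]
  rw [add_comm z.2 (2 • z.1), add_comm (2 • z.2) z.1]
  ring

theorem commonCoboundary_eq_sub_shear (𝕜 : Type*) [RCLike 𝕜] (z : Torus2) :
    commonCoboundary 𝕜 z = shearTransfer 𝕜 z - shearTransfer 𝕜 (torusAlpha2 z) := by
  simp only [commonCoboundary, shearTransfer, torusAlpha2, ContinuousMap.coe_mk]
  rw [circleDist_sub_comm 𝕜 (2 • z.1) z.2,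
    show z.1 + z.2 - 2 • z.1 = z.2 - z.1 by abel,
    show z.1 + z.2 - z.1 = z.2 by abel,
    show z.1 + (z.1 + z.2) = 2 • z.1 + z.2 by abel,
    show 2 • (z.1 + z.2) - z.1 = z.1 + 2 • z.2 by abel]
  ring

theorem commonCoboundary_ne_zero (𝕜 : Type*) [RCLike 𝕜] : commonCoboundary 𝕜 ≠ 0 := by
  intro h
  have h_eval := DFunLike.congr_fun h
    ((((1 / 4 : ℝ) : UnitAddCircle), ((1 / 8 : ℝ) : UnitAddCircle)) : Torus2)
  simp only [commonCoboundary, circleDist, ContinuousMap.coe_mk, ContinuousMap.zero_apply,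
    ← AddCircle.coe_nsmul, ← AddCircle.coe_add, ← AddCircle.coe_sub,
    UnitAddCircle.norm_eq] at h_eval
  norm_cast at h_eval
  norm_num [round_eq, abs_of_pos] at h_eval

theorem mainTheorem8 (𝕜 : Type*) [RCLike 𝕜] :
    ∃ F : Lp 𝕜 2 (volume : Measure Torus2), F ≠ 0 ∧
      IsCoboundary 𝕜 torusAlpha1 measurePreserving_torusAlpha1 F ∧
      IsCoboundary 𝕜 torusAlpha2 measurePreserving_torusAlpha2 F := by
  refine ⟨ContinuousMap.toLp 2 volume 𝕜 (commonCoboundary 𝕜), ?_, ?_, ?_⟩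
  · rw [Ne, map_eq_zero_iff _ (ContinuousMap.toLp_injective (𝕜 := 𝕜) volume)]
    exact commonCoboundary_ne_zero 𝕜
  · refine isCoboundary_toLp 𝕜 _ _ ((1 / 2 : 𝕜) • commonCoboundary 𝕜) fun z => ?_
    simp only [ContinuousMap.smul_apply, smul_eq_mul, commonCoboundary_swap]
    ring
  · exact isCoboundary_toLp 𝕜 _ _ (shearTransfer 𝕜) (commonCoboundary_eq_sub_shear 𝕜)
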